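/- For positive integers $a,d,n$, let $q_d^{(a)}(n)$ be the number of partitions of $n$ into parts that are all at least $a$ and that differ from each other by at least $d$ (so in particular the parts are distinct). For $1\le a\le d+2$, let $Q_d^{(a,-,-)}(n)$ be the number of partitions of $n$ into parts congruent to $\pm a$ modulo $d+3$ in which neither $a$ nor $d+3-a$ occurs as a part. Put $$\Delta_d^{(a,-,-)}(n) := q_d^{(a)}(n)-Q_d^{(a,-,-)}(n).$$ Let $a\ge 3$ be an integer and let $d=2^{a-1}m$ with an integer $m\ge 31$. Let $r$ be the largest integer such that $2^r-2^{a-1}\le d$, and suppose that $m\neq 2^{r-a+1}-1$. Then for all integers $n\ge 2m+2^{r-a+1}+1$, $$\Delta_d^{(a,-,-)}(2^{a-1}n)\ge 0.$$ -/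

import Mathlib

namespace AlderPartitions

/-- `p(n | P)`: the number of partitions of `n` satisfying the condition `P`. -/
noncomputable def partitionCount (n : ℕ) (P : n.Partition → Prop) : ℕ :=
  Nat.card {p : n.Partition // P p}

/-- `q_d^{(a)}(n)`: the number of partitions of `n` all of whose parts are at least `a` and
whose parts (listed with multiplicity) differ from each other by at least `d`. -/
noncomputable def qCount (d a n : ℕ) : ℕ :=
  partitionCount n fun p =>
    (∀ x ∈ p.parts, a ≤ x) ∧ p.parts.Pairwise (fun x y => x + d ≤ y ∨ y + d ≤ x)

/-- `Q_d^{(b,-,-)}(n)`: the number of partitions of `n` into parts congruent to `±b` modulo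
`d + 3`, where the parts `b` and `d + 3 - b` are not allowed. -/
noncomputable def QDashDashCount (d b n : ℕ) : ℕ :=
  partitionCount n fun p =>
    ∀ x ∈ p.parts,
      ((x : ℤ) ≡ (b : ℤ) [ZMOD (d : ℤ) + 3] ∨ (x : ℤ) ≡ -(b : ℤ) [ZMOD (d : ℤ) + 3]) ∧
        (x : ℤ) ≠ (b : ℤ) ∧ (x : ℤ) ≠ (d : ℤ) + 3 - (b : ℤ)

/-- `Δ_d^{(a,b,-,-)}(n) = q_d^{(a)}(n) - Q_d^{(b,-,-)}(n)`, an integer. -/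
noncomputable def DeltaDashDash (d a b n : ℕ) : ℤ :=
  (qCount d a n : ℤ) - (QDashDashCount d b n : ℤ)

/-- `Δ_d^{(a,-,-)}(n) = Δ_d^{(a,a,-,-)}(n)`. -/
noncomputable def DeltaDashDashSame (d a n : ℕ) : ℤ :=
  DeltaDashDash d a a n

end AlderPartitions

/-! Both counts are compared through C = ⌊N / (d - a)⌋, where N = 2^(a-1) n ≥ 2d. The hypotheses on
a and m enter only through d ≥ 124 and 124a ≤ 3d, so that d - a is nearly d.

Lower bound for q (`pow_div_le_qCount`): keep only partitions with exactly k + 1 parts. Fixing the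
smallest part and recursing gives at least B^k / ((k+1)! k!) of them, with B about 121C - 62k².

Upper bound for Q (`QDashDashCount_le`): the admissible parts are d+3+a and i(d+3) ± a with i ≥ 2.
As N is fixed, the multiplicity of d+3+a is determined by the others. A part of index i is at least
i(d - a), so the remaining multiplicities, weighted by i, total at most C. Chernoff's bound gives Q
≤ x^(-C) ∏_{j≥2} (1 - x^j)^(-2) for every 0 < x < 1.

With k = ⌊√C⌋ and x = k/(k+2), Euler's product turns this into exp(O(k)) with an explicit constant;
the lower bound with k parts grows faster (`exp_le_const_mul_pow_div_factorial`). Small C, below 25,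
is settled numerically. -/

/-! ### Lower bound for q: partitions with a fixed number of parts -/

open Finset in
/-- Summing a power along an arithmetic progression, compared with the corresponding integral. -/
theorem pow_succ_le_mul_sum_pow_sub (k e : ℕ) (hk : 0 < k) (M : ℕ) :
    M ^ (e + 1) ≤ k * (e + 1) * ∑ f ∈ range (M / k + 1), (M - k * f) ^ e := by
  induction M using Nat.strong_induction_on with
  | _ M ih =>
    rcases lt_or_ge M k with h | h
    · rw [Nat.div_eq_of_lt h]
      simp only [zero_add, range_one, sum_singleton, mul_zero, Nat.sub_zero]
      rw [pow_succ']
      gcongr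
      nlinarith
    · obtain ⟨y, rfl⟩ := Nat.exists_eq_add_of_le' h
      -- The tangent-line inequality for the convex function t^(e+1) at y + k.
      have step : (y + k) ^ (e + 1) ≤ y ^ (e + 1) + k * (e + 1) * (y + k) ^ e := by
        clear ih h
        induction e with
        | zero => simp
        | succ e ihe =>
          calc (y + k) ^ (e + 1 + 1) = (y + k) ^ (e + 1) * y + k * (y + k) ^ (e + 1) := by ring
            _ ≤ (y ^ (e + 1) + k * (e + 1) * (y + k) ^ e) * y + k * (y + k) ^ (e + 1) := by gcongr
            _ = y ^ (e + 1 + 1) + k * (e + 1) * ((y + k) ^ e * y) + k * (y + k) ^ (e + 1) := by ring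
            _ ≤ y ^ (e + 1 + 1) + k * (e + 1) * ((y + k) ^ e * (y + k))
                  + k * (y + k) ^ (e + 1) := by gcongr; omega
            _ = _ := by ring
      rw [Nat.add_div_right _ hk, sum_range_succ']
      have h1 : ∀ f, y + k - k * (f + 1) = y - k * f := fun f => by
        rw [mul_add, mul_one]; omega
      simp only [h1, mul_zero, Nat.sub_zero]
      have := ih y (by omega)
      nlinarith

/-- For `M = N - k * a - d * k * (k - 1) / 2`, there are at least `M ^ (k - 1) / (k! * (k - 1)!)`
multisets of sum `N` whose elements are at least `a` and differ pairwise by at least `d`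
(stated with `k + 1` in place of `k`). -/
theorem exists_finset_spread_multisets (d k : ℕ) : ∀ a N M : ℕ,
    N = (k + 1) * a + d * (k + 1).choose 2 + M →
    ∃ F : Finset (Multiset ℕ),
      (∀ s ∈ F, s.sum = N ∧ (∀ x ∈ s, a ≤ x) ∧
        s.Pairwise (fun x y => x + d ≤ y ∨ y + d ≤ x)) ∧
      M ^ k ≤ (k + 1).factorial * k.factorial * F.card := by
  induction k with
  | zero =>
    intro a N M h
    refine ⟨{{N}}, ?_, by simp⟩
    intro s hs
    rw [Finset.mem_singleton] at hs
    subst hs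
    refine ⟨by simp, ?_, [N], rfl, by simp⟩
    intro x hx
    rw [Multiset.mem_singleton] at hx
    simp at h
    omega
  | succ k ih =>
    intro a N M h
    have key : ∀ f ∈ Finset.range (M / (k + 2) + 1),
        N - (a + f) = (k + 1) * (a + f + d) + d * (k + 1).choose 2 + (M - (k + 2) * f) := by
      intro f hf
      have hf' : (k + 2) * f ≤ M := by
        have : f ≤ M / (k + 2) := by simpa [Nat.lt_succ_iff] using hf
        calc (k + 2) * f ≤ (k + 2) * (M / (k + 2)) := by gcongr
          _ ≤ M := Nat.mul_div_le _ _
      obtain ⟨M', rfl⟩ := Nat.exists_eq_add_of_le hf'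
      have hc : (k + 1 + 1).choose 2 = (k + 1) + (k + 1).choose 2 := by
        rw [Nat.choose_succ_succ' (k + 1) 1, Nat.choose_one_right]
      rw [hc] at h
      rw [Nat.add_sub_cancel_left, h]
      apply Nat.sub_eq_of_eq_add
      ring
    -- The smallest element is a + f, so the others start at a + f + d; raising f by 1 costs k + 2
    -- units of the slack M.
    choose! F hF hcard using fun f => ih (a + f + d) (N - (a + f)) (M - (k + 2) * f)
    have hle : ∀ f ∈ Finset.range (M / (k + 2) + 1), a + f ≤ N := by
      intro f hf
      have hf' : f ≤ M / (k + 2) := by simpa [Nat.lt_succ_iff] using hf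
      have : M / (k + 2) ≤ M := Nat.div_le_self _ _
      have : a ≤ (k + 1 + 1) * a := Nat.le_mul_of_pos_left _ (by omega)
      omega
    refine ⟨(Finset.range (M / (k + 2) + 1)).biUnion
      fun f => (F f).image (Multiset.cons (a + f)), ?_, ?_⟩
    · intro s hs
      simp only [Finset.mem_biUnion, Finset.mem_image] at hs
      obtain ⟨f, hf, t, ht, rfl⟩ := hs
      obtain ⟨h1, h2, l, rfl, h3⟩ := hF f (key f hf) t ht
      have := hle f hf
      refine ⟨?_, ?_, (a + f) :: l, rfl, ?_⟩
      · rw [Multiset.sum_cons, h1]; omega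
      · intro x hx
        rcases Multiset.mem_cons.1 hx with rfl | hx
        · omega
        · have := h2 x hx; omega
      · rw [List.pairwise_cons]
        exact ⟨fun y hy => Or.inl (h2 y (by simpa using hy)), h3⟩
    · rw [Finset.card_biUnion]
      · have hsum : ∑ f ∈ Finset.range (M / (k + 2) + 1), (M - (k + 2) * f) ^ k ≤
            (k + 1).factorial * k.factorial * ∑ f ∈ Finset.range (M / (k + 2) + 1),
              ((F f).image (Multiset.cons (a + f))).card := by
          rw [Finset.mul_sum]
          apply Finset.sum_le_sum
          intro f hf
          rw [Finset.card_image_of_injective _ (fun _ _ h => (Multiset.cons_inj_right _).1 h)]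
          exact hcard f (key f hf)
        calc M ^ (k + 1) ≤ (k + 2) * (k + 1) *
              ∑ f ∈ Finset.range (M / (k + 2) + 1), (M - (k + 2) * f) ^ k :=
              pow_succ_le_mul_sum_pow_sub _ _ (by omega) _
          _ ≤ (k + 2) * (k + 1) * ((k + 1).factorial * k.factorial *
              ∑ f ∈ Finset.range (M / (k + 2) + 1),
                ((F f).image (Multiset.cons (a + f))).card) := by gcongr
          _ = _ := by
            rw [Nat.factorial_succ (k + 1), Nat.factorial_succ k]
            ring
      -- The families are disjoint because f is recovered from the minimum of the multiset.
      · have aux : ∀ f ∈ Finset.range (M / (k + 2) + 1), ∀ g ∈ Finset.range (M / (k + 2) + 1),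
            ∀ s ∈ F f, ∀ t ∈ F g, (a + f) ::ₘ s = (a + g) ::ₘ t → g ≤ f := by
          intro f hf g hg s hs t ht hst
          have : a + f ∈ (a + g) ::ₘ t := hst ▸ Multiset.mem_cons_self _ _
          rcases Multiset.mem_cons.1 this with h | h
          · omega
          · have := (hF g (key g hg) t ht).2.1 _ h
            omega
        intro f hf g hg hfg
        rw [Function.onFun, Finset.disjoint_left]
        intro u hu hv
        obtain ⟨s, hs, rfl⟩ := Finset.mem_image.1 hu
        obtain ⟨t, ht, hst⟩ := Finset.mem_image.1 hv
        exact hfg (le_antisymm (aux g hg f hf t ht s hs hst) (aux f hf g hg s hs t ht hst.symm))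

namespace AlderPartitions

theorem pow_le_mul_qCount (d a k N M : ℕ) (ha : 0 < a)
    (h : N = (k + 1) * a + d * (k + 1).choose 2 + M) :
    M ^ k ≤ (k + 1).factorial * k.factorial * qCount d a N := by
  obtain ⟨F, hF, hM⟩ := exists_finset_spread_multisets d k a N M h
  refine hM.trans (Nat.mul_le_mul_left _ ?_)
  rw [qCount, partitionCount, ← Nat.card_eq_finsetCard]
  refine Nat.card_le_card_of_injective
    (fun s => ⟨⟨s.1, fun {i} hi => ha.trans_le ((hF s.1 s.2).2.1 i hi), (hF s.1 s.2).1⟩,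
      (hF s.1 s.2).2⟩) ?_
  intro s t hst
  exact Subtype.ext (congrArg (fun p => p.1.parts) hst)

/-- A lower bound for `qCount` in terms of `C = N / (d - a)`, when `a` is small against `d`. -/
theorem pow_div_le_qCount (d a k N C B : ℕ) (ha : 0 < a) (hd : 124 ≤ d) (had : 124 * a ≤ 3 * d)
    (hC : C * (d - a) ≤ N) (hB : B + 62 * (k + 1) ^ 2 ≤ 121 * C + 59 * (k + 1)) :
    (B : ℝ) ^ k / ((k + 1).factorial * k.factorial) ≤ qCount d a N := by
  have hch : (k + 1).choose 2 * 2 = (k + 1) * k := by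
    rw [Nat.choose_two_right]
    exact Nat.div_mul_cancel (Nat.even_mul_pred_self (k + 1)).two_dvd
  -- In units of d/124: a is at most 3, d - a at least 121, and B at most B such units. Then `hB`
  -- reads B + 62k(k+1) + 3(k+1) ≤ 121C.
  have hBN : (k + 1) * a + d * (k + 1).choose 2 + B ≤ N := by
    obtain ⟨D, rfl⟩ := Nat.exists_eq_add_of_le (show a ≤ d by omega)
    rw [Nat.add_sub_cancel_left] at hC
    refine le_trans ?_ hC
    generalize (k + 1).choose 2 = c at *
    zify at *
    have e1 : (B : ℤ) + 124 * c ≤ 121 * C - 3 * (k + 1) := by nlinarith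
    have e2 : ((B : ℤ) + 124 * c + 3 * (k + 1) + 3 * C) * (a + D) ≤ 124 * C * (a + D) :=
      mul_le_mul_of_nonneg_right (by linarith) (by positivity)
    have e3 : ((k : ℤ) + 1 + C) * (124 * a) ≤ (k + 1 + C) * (3 * (a + D)) :=
      mul_le_mul_of_nonneg_left had (by positivity)
    have e4 : (B : ℤ) * 124 ≤ B * (a + D) := mul_le_mul_of_nonneg_left hd (by positivity)
    nlinarith
  obtain ⟨M, hM⟩ := Nat.exists_eq_add_of_le hBN
  have := pow_le_mul_qCount d a k N (B + M) ha (by omega)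
  rw [div_le_iff₀ (by positivity)]
  have h2 : B ^ k ≤ qCount d a N * ((k + 1).factorial * k.factorial) := by
    rw [mul_comm]
    exact (Nat.pow_le_pow_left (Nat.le_add_right B M) k).trans this
  exact_mod_cast h2

end AlderPartitions

/-! ### Analytic tools: Euler's product and Chernoff's bound -/

open Finset in
/-- A bound for Euler's product: `∏ 1 / (1 - x ^ j) ≤ exp (ζ(2) * x / (1 - x))`. -/
theorem prod_inv_one_sub_pow_le_exp (x : ℝ) (hx0 : 0 < x) (hx1 : x < 1) (J : ℕ) :
    ∏ j ∈ range J, (1 - x ^ (j + 1))⁻¹ ≤ Real.exp (Real.pi ^ 2 / 6 * (x / (1 - x))) := by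
  have hlt : ∀ j : ℕ, x ^ (j + 1) < 1 := fun j => pow_lt_one₀ hx0.le hx1 (by omega)
  have hpos : ∀ j : ℕ, 0 < 1 - x ^ (j + 1) := fun j => by linarith [hlt j]
  -- Expand the logarithms and sum over j first: the r-th term is at most x^(r+1) / ((r+1)(1 -
  -- x^(r+1))), hence at most x / ((r+1)²(1 - x)), which sums to the ζ(2) bound.
  have hlog : HasSum (fun r : ℕ => ∑ j ∈ range J, (x ^ (j + 1)) ^ (r + 1) / ((r : ℝ) + 1))
      (∑ j ∈ range J, -Real.log (1 - x ^ (j + 1))) :=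
    hasSum_sum fun j _ => Real.hasSum_pow_div_log_of_abs_lt_one
      (by rw [abs_of_pos (by positivity)]; exact hlt j)
  have hz : HasSum (fun r : ℕ => 1 / ((r : ℝ) + 1) ^ 2 * (x / (1 - x)))
      (Real.pi ^ 2 / 6 * (x / (1 - x))) := by
    have h := (hasSum_nat_add_iff' 1).2 hasSum_zeta_two
    simp only [sum_range_one, Nat.cast_zero, Nat.cast_add, Nat.cast_one] at h
    simpa using h.mul_right (x / (1 - x))
  have hle : ∑ j ∈ range J, -Real.log (1 - x ^ (j + 1)) ≤ Real.pi ^ 2 / 6 * (x / (1 - x)) := by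
    refine hasSum_le (fun r => ?_) hlog hz
    have hy0 : 0 < x ^ (r + 1) := by positivity
    have hg : ∑ j ∈ range J, (x ^ (j + 1)) ^ (r + 1) ≤ x ^ (r + 1) / (1 - x ^ (r + 1)) := by
      have : ∀ j ∈ range J, (x ^ (j + 1)) ^ (r + 1) = x ^ (r + 1) * (x ^ (r + 1)) ^ j := by
        intro j _
        rw [← pow_mul, ← pow_mul, ← pow_add]; ring_nf
      rw [sum_congr rfl this, ← mul_sum, div_eq_mul_inv]
      refine mul_le_mul_of_nonneg_left ?_ hy0.le
      rw [geom_sum_eq (hlt r).ne, ← neg_div_neg_eq, neg_sub, neg_sub, inv_eq_one_div]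
      have := hpos r
      gcongr
      linarith [pow_pos hy0 J]
    have hgeom : ((r : ℝ) + 1) * x ^ (r + 1) * (1 - x) ≤ x * (1 - x ^ (r + 1)) := by
      have : ((r : ℝ) + 1) * x ^ r * (1 - x) ≤ 1 - x ^ (r + 1) := by
        clear hg hy0
        induction r with
        | zero => simp
        | succ r ih =>
          push_cast
          rw [pow_succ x (r + 1)]
          have h1 := mul_le_mul_of_nonneg_left ih hx0.le
          have h2 := mul_nonneg (sub_pos.2 hx1).le (hpos r).le
          rw [pow_succ] at h1 h2 ⊢
          nlinarith
      calc ((r : ℝ) + 1) * x ^ (r + 1) * (1 - x) = x * (((r : ℝ) + 1) * x ^ r * (1 - x)) := by ring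
        _ ≤ x * (1 - x ^ (r + 1)) := by gcongr
    rw [← sum_div]
    calc (∑ j ∈ range J, (x ^ (j + 1)) ^ (r + 1)) / ((r : ℝ) + 1)
        ≤ x ^ (r + 1) / (1 - x ^ (r + 1)) / ((r : ℝ) + 1) := by gcongr
      _ ≤ 1 / ((r : ℝ) + 1) ^ 2 * (x / (1 - x)) := by
        have := hpos r
        have h1 : 0 < 1 - x := by linarith
        rw [div_div, div_mul_div_comm, one_mul, div_le_div_iff₀ (by positivity) (by positivity)]
        have h2 : (0 : ℝ) < (r : ℝ) + 1 := by positivity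
        nlinarith [mul_le_mul_of_nonneg_left hgeom h2.le]
  rw [← Real.exp_log (prod_pos fun j _ => inv_pos.2 (hpos j)),
    Real.log_prod (fun j _ => (inv_pos.2 (hpos j)).ne')]
  simpa only [Real.log_inv] using Real.exp_le_exp.2 hle

open Finset in
/-- Chernoff's bound for the number of tuples of natural numbers of bounded weight. -/
theorem card_le_pow_mul_prod {ι : Type*} [Fintype ι] [DecidableEq ι] (w : ι → ℕ)
    (hw : ∀ i, 0 < w i) (C : ℕ) (T : Finset (ι → ℕ)) (hT : ∀ f ∈ T, ∑ i, w i * f i ≤ C)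
    (x : ℝ) (hx0 : 0 < x) (hx1 : x < 1) :
    (T.card : ℝ) ≤ (x⁻¹) ^ C * ∏ i, (1 - x ^ w i)⁻¹ := by
  have hlt : ∀ i, x ^ w i < 1 := fun i => pow_lt_one₀ hx0.le hx1 (hw i).ne'
  -- Positive weights confine T to a finite box, over which the sum factors into finite geometric
  -- series.
  have hsub : T ⊆ Fintype.piFinset fun _ : ι => range (C + 1) := by
    intro f hf
    rw [Fintype.mem_piFinset]
    intro i
    rw [mem_range, Nat.lt_succ_iff]
    calc f i ≤ w i * f i := Nat.le_mul_of_pos_left _ (hw i)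
      _ ≤ ∑ i, w i * f i := single_le_sum (f := fun i => w i * f i) (by simp) (mem_univ i)
      _ ≤ C := hT f hf
  have h1 : (T.card : ℝ) * x ^ C ≤ ∏ i, (1 - x ^ w i)⁻¹ := by
    calc (T.card : ℝ) * x ^ C = ∑ f ∈ T, x ^ C := by simp
      _ ≤ ∑ f ∈ T, ∏ i, (x ^ w i) ^ f i := by
        refine sum_le_sum fun f hf => ?_
        simp only [← pow_mul]
        rw [prod_pow_eq_pow_sum]
        exact pow_le_pow_of_le_one hx0.le hx1.le (hT f hf)
      _ ≤ ∑ f ∈ Fintype.piFinset fun _ : ι => range (C + 1), ∏ i, (x ^ w i) ^ f i :=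
        sum_le_sum_of_subset_of_nonneg hsub fun f _ _ => prod_nonneg fun i _ => by positivity
      _ = ∏ i, ∑ j ∈ range (C + 1), (x ^ w i) ^ j :=
        sum_prod_piFinset (range (C + 1)) fun i j => (x ^ w i) ^ j
      _ ≤ ∏ i, (1 - x ^ w i)⁻¹ := by
        refine prod_le_prod (fun i _ => sum_nonneg fun j _ => by positivity) fun i _ => ?_
        have := hlt i
        rw [geom_sum_eq this.ne, ← neg_div_neg_eq, neg_sub, neg_sub, inv_eq_one_div]
        have h2 : 0 < 1 - x ^ w i := by linarith
        gcongr
        linarith [pow_pos (pow_pos hx0 (w i)) (C + 1)]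
  rw [inv_pow, mul_comm, ← div_eq_mul_inv, le_div_iff₀ (by positivity)]
  exact h1

/-! ### Upper bound for Q: encoding partitions by multiplicities -/

namespace AlderPartitions

/-- The numbers congruent to `±a` modulo `d + 3`, listed by index. -/
def residuePart (d a : ℕ) (i : ℕ × Bool) : ℕ :=
  if i.2 then i.1 * (d + 3) + a else i.1 * (d + 3) - a

theorem residuePart_injOn (d a : ℕ) (ha : 0 < a) (had : 2 * a ≤ d) :
    Set.InjOn (residuePart d a) {i | 2 ≤ i.1} := by
  rintro ⟨k, b⟩ hk ⟨l, c⟩ hl h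
  simp only [Set.mem_ofPred_eq] at hk hl
  have hk' := Nat.mul_le_mul_right (d + 3) hk
  have hl' := Nat.mul_le_mul_right (d + 3) hl
  -- The two signs never collide, since 0 < 2a < d + 3.
  have cross : ∀ u v : ℕ, u * (d + 3) + a + a ≠ v * (d + 3) := by
    intro u v huv
    rcases le_or_gt v u with h1 | h1
    · have := Nat.mul_le_mul_right (d + 3) h1
      omega
    · have := Nat.mul_le_mul_right (d + 3) (Nat.succ_le_of_lt h1)
      rw [Nat.succ_mul] at this
      omega
  have same : ∀ u v : ℕ, u * (d + 3) = v * (d + 3) → u = v := fun u v huv =>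
    Nat.eq_of_mul_eq_mul_right (by omega) huv
  cases b <;> cases c <;> simp only [residuePart, if_true, Bool.false_eq_true, if_false] at h
  · rw [same k l (by omega)]
  · exact absurd (by omega) (cross l k)
  · exact absurd (by omega) (cross k l)
  · rw [same k l (by omega)]

theorem eq_residuePart_of_modEq (d a x : ℕ) (had : 2 * a ≤ d)
    (h : ((x : ℤ) ≡ (a : ℤ) [ZMOD (d : ℤ) + 3] ∨ (x : ℤ) ≡ -(a : ℤ) [ZMOD (d : ℤ) + 3]) ∧
      (x : ℤ) ≠ (a : ℤ) ∧ (x : ℤ) ≠ (d : ℤ) + 3 - (a : ℤ)) (hx : 0 < x) :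
    x = d + 3 + a ∨ ∃ i : ℕ × Bool, 2 ≤ i.1 ∧ x = residuePart d a i := by
  obtain ⟨h | h, h1, h2⟩ := h
  · obtain ⟨k, hk⟩ := Int.modEq_iff_dvd.1 h.symm
    have hk0 : 0 < k := by
      by_contra! hneg
      rcases hneg.lt_or_eq with h0 | h0
      · have : ((d : ℤ) + 3) * k ≤ (d + 3) * (-1) :=
          mul_le_mul_of_nonneg_left (by omega) (by positivity)
        omega
      · rw [h0, mul_zero] at hk; omega
    lift k to ℕ using hk0.le
    have hxe : x = k * (d + 3) + a := by zify; linarith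
    rcases Nat.lt_or_ge k 2 with h3 | h3
    · left
      have : k = 1 := by omega
      rw [hxe, this, one_mul]
    · exact Or.inr ⟨(k, true), h3, by simp [residuePart, hxe]⟩
  · obtain ⟨k, hk⟩ := Int.modEq_iff_dvd.1 h.symm
    have hk0 : 0 < k := by
      by_contra! hneg
      have : ((d : ℤ) + 3) * k ≤ (d + 3) * 0 :=
        mul_le_mul_of_nonneg_left hneg (by positivity)
      omega
    lift k to ℕ using hk0.le
    have hxe : x + a = k * (d + 3) := by zify; linarith
    rcases Nat.lt_or_ge k 2 with h3 | h3
    · have : k = 1 := by omega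
      rw [this, one_mul] at hxe
      omega
    · exact Or.inr ⟨(k, false), h3, by simp [residuePart]; omega⟩

theorem mul_le_residuePart (d a : ℕ) (i : ℕ × Bool) (hi : 2 ≤ i.1) :
    i.1 * (d - a) ≤ residuePart d a i := by
  obtain ⟨k, b⟩ := i
  have h1 : k * (d - a) ≤ k * (d + 3) - a := by
    rcases le_total d a with h | h
    · simp [Nat.sub_eq_zero_of_le h]
    · obtain ⟨D, rfl⟩ := Nat.exists_eq_add_of_le h
      rw [Nat.add_sub_cancel_left]
      apply Nat.le_sub_of_add_le
      have : 2 * a ≤ k * a := Nat.mul_le_mul_right _ hi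
      nlinarith
  cases b <;> simp only [residuePart, if_true, Bool.false_eq_true, if_false]
  · exact h1
  · omega

/-- A multiset is determined by its sum and its elements other than a given positive number. -/
theorem multiset_eq_of_count_eq_of_sum_eq {s t : Multiset ℕ} {y : ℕ} (hy : 0 < y)
    (hc : ∀ x, x ≠ y → s.count x = t.count x) (hs : s.sum = t.sum) : s = t := by
  classical
  ext x
  by_cases hx : x = y
  · subst hx
    have key : ∀ u : Multiset ℕ, u.sum = u.count x * x + (u.filter (· ≠ x)).sum := by
      intro u
      conv_lhs => rw [← Multiset.filter_add_not (· = x) u]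
      rw [Multiset.sum_add, Multiset.filter_eq', Multiset.sum_replicate, smul_eq_mul]
    have hf : s.filter (· ≠ x) = t.filter (· ≠ x) := by
      ext z
      rw [Multiset.count_filter, Multiset.count_filter]
      split_ifs with hz
      · exact hc z hz
      · rfl
    have h1 := key s
    have h2 := key t
    rw [hf] at h1
    exact Nat.eq_of_mul_eq_mul_right hy (by omega)
  · exact hc x hx

/-- Only d+3+a survives among the parts of index below 2, and its multiplicity is forced by the sum.
Recording the other multiplicities is therefore injective, and Chernoff's bound applies with each
weight 2, ..., C occurring twice, once per sign. -/
theorem QDashDashCount_le (d a N C : ℕ) (ha : 0 < a) (had : 2 * a ≤ d)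
    (hC : N < (C + 1) * (d - a)) (x : ℝ) (hx0 : 0 < x) (hx1 : x < 1) :
    (QDashDashCount d a N : ℝ) ≤
      (x⁻¹) ^ C * ∏ j ∈ Finset.range (C - 1), ((1 - x ^ (j + 2))⁻¹) ^ 2 := by
  classical
  let g : Fin (C - 1) × Bool → ℕ := fun i => residuePart d a (i.1 + 2, i.2)
  have hg : Function.Injective g := by
    rintro ⟨i, b⟩ ⟨j, c⟩ h
    have := residuePart_injOn d a ha had (x₁ := (i + 2, b)) (x₂ := (j + 2, c))
      (by simp) (by simp) h
    simp only [Prod.mk.injEq, add_left_inj, Fin.val_inj] at this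
    simp [this]
  let P : N.Partition → Prop := fun p =>
    ∀ x ∈ p.parts,
      ((x : ℤ) ≡ (a : ℤ) [ZMOD (d : ℤ) + 3] ∨ (x : ℤ) ≡ -(a : ℤ) [ZMOD (d : ℤ) + 3]) ∧
        (x : ℤ) ≠ (a : ℤ) ∧ (x : ℤ) ≠ (d : ℤ) + 3 - (a : ℤ)
  let Φ : {p : N.Partition // P p} → (Fin (C - 1) × Bool → ℕ) := fun p i => p.1.parts.count (g i)
  have hpart : ∀ p : {p : N.Partition // P p}, ∀ y ∈ p.1.parts, y ≠ d + 3 + a → ∃ i, y = g i := by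
    intro p y hy hne
    obtain h | ⟨⟨k, b⟩, hk, h⟩ :=
      eq_residuePart_of_modEq d a y had (p.2 y hy) (p.1.parts_pos hy)
    · exact absurd h hne
    · have h1 := mul_le_residuePart d a (k, b) hk
      have h2 : y ≤ N := by
        rw [← p.1.parts_sum]; exact Multiset.le_sum_of_mem hy
      have h3 : k < C + 1 := lt_of_mul_lt_mul_right (by simp only at h1 hk; omega) (Nat.zero_le (d - a))
      refine ⟨(⟨k - 2, by simp only at hk; omega⟩, b), ?_⟩
      simp only at hk
      rw [h]
      simp only [g]
      rw [Nat.sub_add_cancel hk]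
  have hΦ : Function.Injective Φ := by
    intro p q hpq
    apply Subtype.ext
    apply Nat.Partition.ext
    refine multiset_eq_of_count_eq_of_sum_eq (y := d + 3 + a) (by omega) ?_
      (p.1.parts_sum.trans q.1.parts_sum.symm)
    intro y hy
    by_cases h : ∃ i, y = g i
    · obtain ⟨i, rfl⟩ := h
      exact congrFun hpq i
    · rw [Multiset.count_eq_zero_of_notMem fun hm => h (hpart p y hm hy),
        Multiset.count_eq_zero_of_notMem fun hm => h (hpart q y hm hy)]
  have hw : ∀ p, ∑ i, (i.1 + 2) * Φ p i ≤ C := by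
    intro p
    have h1 : ∑ i, g i * Φ p i ≤ N := by
      rw [← p.1.parts_sum, Finset.sum_multiset_count_of_subset p.1.parts
        (p.1.parts.toFinset ∪ Finset.univ.image g) Finset.subset_union_left]
      refine le_trans ?_ (Finset.sum_le_sum_of_subset Finset.subset_union_right)
      rw [Finset.sum_image fun i _ j _ h => hg h]
      simp [Φ, mul_comm]
    have h2 : (∑ i, (i.1 + 2) * Φ p i) * (d - a) ≤ N := by
      refine le_trans ?_ h1
      rw [Finset.sum_mul]
      refine Finset.sum_le_sum fun i _ => ?_
      rw [mul_right_comm]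
      exact Nat.mul_le_mul_right _ (mul_le_residuePart d a (i.1 + 2, i.2) (by simp))
    exact Nat.lt_succ_iff.1 (lt_of_mul_lt_mul_right (h2.trans_lt hC) (Nat.zero_le _))
  have hcard : QDashDashCount d a N = (Finset.univ.image Φ).card := by
    rw [Finset.card_image_of_injective _ hΦ, Finset.card_univ, ← Nat.card_eq_fintype_card]
    rfl
  rw [hcard]
  refine (card_le_pow_mul_prod (fun i : Fin (C - 1) × Bool => i.1 + 2) (fun i => by simp) C
    (Finset.univ.image Φ) ?_ x hx0 hx1).trans (le_of_eq ?_)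
  · intro f hf
    obtain ⟨p, -, rfl⟩ := Finset.mem_image.1 hf
    exact hw p
  · rw [Fintype.prod_prod_type, ← Fin.prod_univ_eq_prod_range fun j => ((1 - x ^ (j + 2))⁻¹) ^ 2]
    simp [sq]

/-! ### Comparison of the two bounds -/

/-- When k increases by 1, the left side gains the factor e^3.645 < 59 and the right side at least
59(k+7)/(k+5) > 59, so only k = 0 needs a computation. -/
theorem exp_le_const_mul_pow_div_factorial (k : ℕ) :
    Real.exp (2 * (k + 7) + 3.29 / 2 * (k + 5)) ≤
      12.25 * ((59 * (k + 5) * (k + 6) : ℝ) ^ (k + 4) / ((k + 5).factorial * (k + 4).factorial)) := by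
  have hexp : ∀ n : ℕ, Real.exp n ≤ 2.7182818286 ^ n := fun n => by
    rw [← Real.exp_one_pow]
    exact pow_le_pow_left₀ (Real.exp_pos 1).le Real.exp_one_lt_d9.le n
  induction k with
  | zero =>
    calc Real.exp (2 * ((0 : ℕ) + 7) + 3.29 / 2 * ((0 : ℕ) + 5)) ≤ Real.exp (23 : ℕ) := by
          apply Real.exp_le_exp.2; norm_num
      _ ≤ 2.7182818286 ^ 23 := hexp 23
      _ ≤ _ := by norm_num [Nat.factorial]
  | succ k ih =>
    have h4 : Real.exp (2 + 3.29 / 2) ≤ 59 := by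
      calc Real.exp (2 + 3.29 / 2) ≤ Real.exp (4 : ℕ) := by
            apply Real.exp_le_exp.2; norm_num
        _ ≤ 2.7182818286 ^ 4 := hexp 4
        _ ≤ 59 := by norm_num
    have e1 : Real.exp (2 * ((k + 1 : ℕ) + 7) + 3.29 / 2 * ((k + 1 : ℕ) + 5)) =
        Real.exp (2 * (k + 7) + 3.29 / 2 * (k + 5)) * Real.exp (2 + 3.29 / 2) := by
      rw [← Real.exp_add]; push_cast; ring_nf
    rw [e1]
    refine (mul_le_mul ih h4 (Real.exp_pos _).le (by positivity)).trans ?_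
    rw [mul_assoc]
    refine mul_le_mul_of_nonneg_left ?_ (by norm_num)
    have f6 : ((k + 1 + 5).factorial : ℝ) = (k + 6) * (k + 5).factorial := by
      rw [show k + 1 + 5 = (k + 5) + 1 by ring, Nat.factorial_succ]
      push_cast; ring
    have f5 : ((k + 1 + 4).factorial : ℝ) = (k + 5) * (k + 4).factorial := by
      rw [show k + 1 + 4 = (k + 4) + 1 by ring, Nat.factorial_succ]
      push_cast; ring
    have hb : (59 * (((k + 1 : ℕ) : ℝ) + 5) * ((k + 1 : ℕ) + 6)) = 59 * (k + 6) * (k + 7) := by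
      push_cast; ring
    rw [f6, f5, hb, show k + 1 + 4 = (k + 4) + 1 by ring, pow_succ _ (k + 4),
      div_mul_eq_mul_div, div_le_div_iff₀ (by positivity) (by positivity)]
    have hpow : (59 * ((k : ℝ) + 5) * (k + 6)) ^ (k + 4) ≤
        (59 * ((k : ℝ) + 6) * (k + 7)) ^ (k + 4) := by
      gcongr <;> linarith
    calc (59 * ((k : ℝ) + 5) * (k + 6)) ^ (k + 4) * 59 *
          (((k : ℝ) + 6) * ((k + 5) * (k + 4).factorial) * ((k + 5) * (k + 4).factorial))
        = (59 * ((k : ℝ) + 5) * (k + 6)) ^ (k + 4) * (59 * (k + 6) * (k + 5)) *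
          ((k + 5) * (k + 4).factorial * (k + 4).factorial) := by ring
      _ ≤ (59 * ((k : ℝ) + 6) * (k + 7)) ^ (k + 4) * (59 * (k + 6) * (k + 7)) *
          ((k + 5) * (k + 4).factorial * (k + 4).factorial) := by
        gcongr; norm_num

/-- The Chernoff bound at `x = k / (k + 2)`, with Euler's product estimated. -/
theorem inv_pow_mul_prod_le_exp (k C : ℕ) (hk : 5 ≤ k) (hC : C ≤ k * (k + 2)) :
    (((k : ℝ) / (k + 2))⁻¹) ^ C *
        ∏ j ∈ Finset.range (C - 1), ((1 - ((k : ℝ) / (k + 2)) ^ (j + 2))⁻¹) ^ 2 ≤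
      Real.exp (2 * (k + 2) + 3.29 / 2 * k) / 12.25 := by
  have hk0 : (5 : ℝ) ≤ k := by exact_mod_cast hk
  have hkp : (0 : ℝ) < k := by linarith
  set x : ℝ := (k : ℝ) / (k + 2) with hx
  have hx0 : 0 < x := by positivity
  have hx1 : x < 1 := by rw [hx, div_lt_one (by positivity)]; linarith
  have h1x : 1 - x = 2 / (k + 2) := by rw [hx]; field_simp; ring
  have hxx : x / (1 - x) = k / 2 := by rw [h1x, hx]; field_simp
  have hpow : (x⁻¹) ^ C ≤ Real.exp (2 * (k + 2)) := by
    have h1 : 1 ≤ x⁻¹ := (one_le_inv₀ hx0).2 hx1.le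
    have h2 : x⁻¹ ≤ Real.exp (2 / k) := by
      have : x⁻¹ = 2 / k + 1 := by rw [hx]; field_simp; ring
      rw [this]; exact Real.add_one_le_exp _
    calc (x⁻¹) ^ C ≤ (x⁻¹) ^ (k * (k + 2)) := pow_le_pow_right₀ h1 hC
      _ ≤ Real.exp (2 / k) ^ (k * (k + 2)) := pow_le_pow_left₀ (by positivity) h2 _
      _ = Real.exp (2 * (k + 2)) := by
        rw [← Real.exp_nat_mul]
        congr 1
        push_cast
        field_simp
  -- The constant 3.29 is 9.87 / 3, an upper bound for 2ζ(2).
  have hpi : Real.pi ^ 2 ≤ 9.87 := by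
    have h1 := Real.pi_lt_d4
    have h2 := Real.pi_pos
    nlinarith
  have hprod := prod_inv_one_sub_pow_le_exp x hx0 hx1 (C - 1 + 1)
  -- Split off the factor 1/(1 - x) = (k+2)/2 ≥ 7/2, absent from the product over weights at least
  -- 2; its square yields 12.25.
  rw [Finset.prod_range_succ', hxx] at hprod
  have h0 : (0 : ℝ) < 1 - x := by linarith
  have hQ0 : 0 ≤ ∏ j ∈ Finset.range (C - 1), (1 - x ^ (j + 2))⁻¹ :=
    Finset.prod_nonneg fun j _ => inv_nonneg.2 (sub_nonneg.2 (pow_le_one₀ hx0.le hx1.le))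
  have hprod2 : ∏ j ∈ Finset.range (C - 1), (1 - x ^ (j + 2))⁻¹ ≤
      2 / 7 * Real.exp (Real.pi ^ 2 / 6 * (k / 2)) := by
    rw [zero_add, pow_one, ← div_eq_mul_inv, div_le_iff₀ h0] at hprod
    refine hprod.trans ?_
    rw [mul_comm]
    gcongr
    rw [h1x]
    gcongr
    linarith
  have hsq : ∏ j ∈ Finset.range (C - 1), ((1 - x ^ (j + 2))⁻¹) ^ 2 ≤
      Real.exp (3.29 / 2 * k) / 12.25 := by
    rw [Finset.prod_pow]
    refine (pow_le_pow_left₀ hQ0 hprod2 2).trans ?_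
    rw [mul_pow, ← Real.exp_nat_mul]
    have : Real.exp ((2 : ℕ) * (Real.pi ^ 2 / 6 * (k / 2))) ≤ Real.exp (3.29 / 2 * k) := by
      apply Real.exp_le_exp.2
      push_cast
      nlinarith
    exact (mul_le_mul_of_nonneg_left this (by norm_num)).trans (le_of_eq (by ring))
  rw [Real.exp_add, mul_div_assoc]
  exact mul_le_mul hpow hsq (Finset.prod_nonneg fun j _ => sq_nonneg _) (Real.exp_pos _).le

/-- The Chernoff bound for all `C` up to a given one. -/
theorem QDashDashCount_le_of_le (d a N C C' : ℕ) (ha : 0 < a) (had : 2 * a ≤ d)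
    (hC : N < (C + 1) * (d - a)) (hCC : C ≤ C') (x : ℝ) (hx0 : 0 < x) (hx1 : x < 1) :
    (QDashDashCount d a N : ℝ) ≤
      (x⁻¹) ^ C' * ∏ j ∈ Finset.range (C' - 1), ((1 - x ^ (j + 2))⁻¹) ^ 2 :=
  QDashDashCount_le d a N C' ha had
    (hC.trans_le (Nat.mul_le_mul_right _ (Nat.succ_le_succ hCC))) x hx0 hx1

theorem QDashDashCount_le_qCount (d a N : ℕ) (ha : 0 < a) (hd : 124 ≤ d)
    (had : 124 * a ≤ 3 * d) (hN : 2 * d ≤ N) :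
    QDashDashCount d a N ≤ qCount d a N := by
  have hda : 0 < d - a := by omega
  have h2a : 2 * a ≤ d := by omega
  obtain ⟨C, hC⟩ : ∃ C, C = N / (d - a) := ⟨_, rfl⟩
  have hlo : C * (d - a) ≤ N := hC ▸ Nat.div_mul_le_self _ _
  have hhi : N < (C + 1) * (d - a) := by
    rw [hC, mul_comm]; exact Nat.lt_mul_div_succ _ hda
  have hC2 : 2 ≤ C := by
    rw [hC, Nat.le_div_iff_mul_le hda]; omega
  have low := pow_div_le_qCount d a (N := N) (C := C) (ha := ha) (hd := hd) (had := had) (hC := hlo)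
  have upp := QDashDashCount_le_of_le d a N C (ha := ha) (had := h2a) (hC := hhi)
  suffices h : (QDashDashCount d a N : ℝ) ≤ qCount d a N by exact_mod_cast h
  -- On each range of C, the upper bound uses its right end and B is the largest value allowed by
  -- `hB` at its left end.
  rcases Nat.lt_or_ge C 25 with h25 | h25
  · rcases Nat.lt_or_ge C 4 with h4 | h4
    · refine (upp 3 (by omega) (5 / 9) (by norm_num) (by norm_num)).trans
        (le_trans ?_ (low 1 112 (by omega)))
      norm_num [Finset.prod_range_succ, Nat.factorial]
    rcases Nat.lt_or_ge C 6 with h6 | h6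
    · refine (upp 5 (by omega) (4 / 7) (by norm_num) (by norm_num)).trans
        (le_trans ?_ (low 1 354 (by omega)))
      norm_num [Finset.prod_range_succ, Nat.factorial]
    rcases Nat.lt_or_ge C 9 with h9 | h9
    · refine (upp 8 (by omega) (5 / 8) (by norm_num) (by norm_num)).trans
        (le_trans ?_ (low 2 345 (by omega)))
      norm_num [Finset.prod_range_succ, Nat.factorial]
    rcases Nat.lt_or_ge C 16 with h16 | h16
    · refine (upp 15 (by omega) (2 / 3) (by norm_num) (by norm_num)).trans
        (le_trans ?_ (low 2 708 (by omega)))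
      norm_num [Finset.prod_range_succ, Nat.factorial]
    · refine (upp 24 (by omega) (2 / 3) (by norm_num) (by norm_num)).trans
        (le_trans ?_ (low 3 1180 (by omega)))
      norm_num [Finset.prod_range_succ, Nat.factorial]
  · obtain ⟨k, hk⟩ : ∃ k, Nat.sqrt C = k + 5 :=
      Nat.exists_eq_add_of_le' (Nat.le_sqrt.2 h25)
    have hk1 : (k + 5) * (k + 5) ≤ C := hk ▸ Nat.sqrt_le C
    have hk2 : C < (k + 5 + 1) * (k + 5 + 1) := hk ▸ Nat.lt_succ_sqrt C
    have hx1 : ((k + 5 : ℕ) : ℝ) / ((k + 5 : ℕ) + 2) < 1 := by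
      rw [div_lt_one (by positivity)]; linarith
    refine (upp C le_rfl (((k + 5 : ℕ) : ℝ) / ((k + 5 : ℕ) + 2)) (by positivity) hx1).trans ?_
    refine (inv_pow_mul_prod_le_exp (k + 5) C (by omega) (by nlinarith)).trans ?_
    -- Here B is the largest value allowed when C is replaced by (k+5)², using 121 - 62 = 59.
    have hB : 59 * (k + 5) * (k + 6) + 62 * (k + 4 + 1) ^ 2 ≤ 121 * C + 59 * (k + 4 + 1) :=
      calc _ = 121 * ((k + 5) * (k + 5)) + 59 * (k + 4 + 1) := by ring
        _ ≤ _ := by gcongr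
    refine le_trans ?_ (low (k + 4) _ hB)
    rw [div_le_iff₀' (by norm_num)]
    refine (le_of_eq ?_).trans ((exp_le_const_mul_pow_div_factorial k).trans (le_of_eq ?_))
    · push_cast; ring_nf
    · push_cast; rfl

end AlderPartitions

theorem mainTheorem6 (a m d r : ℕ) (ha : 3 ≤ a) (hd : d = 2 ^ (a - 1) * m) (hm : 31 ≤ m)
    (hr : IsGreatest {k : ℕ | (2 : ℤ) ^ k - 2 ^ (a - 1) ≤ (d : ℤ)} r)
    (hmr : m ≠ 2 ^ (r - a + 1) - 1) (n : ℕ) (hn : 2 * m + 2 ^ (r - a + 1) + 1 ≤ n) :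
    0 ≤ AlderPartitions.DeltaDashDashSame d a (2 ^ (a - 1) * n) := by
  obtain ⟨b, rfl⟩ := Nat.exists_eq_add_of_le' ha
  -- With a = b + 3 this gives a ≤ 3·2^b; together with d ≥ 31·4·2^b it yields 124a ≤ 3d.
  have hb : b + 1 ≤ 2 ^ b := Nat.lt_two_pow_self
  have hK : 2 ^ (b + 3 - 1) = 4 * 2 ^ b := by
    rw [show b + 3 - 1 = b + 2 by omega, pow_add]; ring
  have hd1 : 2 ^ (b + 3 - 1) * 31 ≤ d := hd ▸ Nat.mul_le_mul_left _ hm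
  have hN : 2 * d ≤ 2 ^ (b + 3 - 1) * n := by
    rw [hd, mul_left_comm]
    exact Nat.mul_le_mul_left _ ((Nat.le_add_right _ _).trans ((Nat.le_add_right _ _).trans hn))
  have := AlderPartitions.QDashDashCount_le_qCount d (b + 3) _ (by omega) (by omega) (by omega) hN
  rw [AlderPartitions.DeltaDashDashSame, AlderPartitions.DeltaDashDash]
  omega
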